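/- **Setting.** Let $\top$ be a positive integer or $+\infty$ and let costs lie in $[0,\top]$, with $a\oplus b=\min(\top,a+b)$ and, for $b\le a$, $a\ominus b=a-b$ if $a\neq\top$ and $\top\ominus b=\top$. (The same holds for nonnegative rational costs with positive rational or infinite $\top$, and generally when the finite costs form a cancellative, canonically ordered, linearly ordered commutative monoid.) A *cost function network* (CFN) over finitely many variables $x$ with finite nonempty domains $D(x)$ consists of a constant $W_\varnothing$, a unary cost function $W_x$ for each variable $x$ (zero if not specified), and finitely many cost functions $W_i$ whose scopes have at least two variables. The cost of a complete assignment is the $\oplus$-sum of all cost functions; the optimal cost is the minimum over all assignments. If a network is given a further unary cost function on $x$, it is added to $W_x$ with $\oplus$. The CFN is *Berge-acyclic* if the bipartite incidence graph between its variables and its cost functions (a variable being adjacent to each cost function whose scope contains it) is acyclic. Let $S_2\subsetneq S_1$ be scopes of cost functions $W_{S_1},W_{S_2}$ of the network, with $|S_2|\le 1$, and let $\ell$ be a tuple over $S_2$. An *equivalence preserving transformation* (EPT) either replaces $W_{S_2}(\ell)$ by $W_{S_2}(\ell)\oplus\alpha$ and $W_{S_1}(\ell')$ by $W_{S_1}(\ell')\ominus\alpha$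 for all tuples $\ell'$ over $S_1$ extending $\ell$, where $0\le\alpha\le\min_{\ell'}W_{S_1}(\ell')$, or replaces $W_{S_2}(\ell)$ by $W_{S_2}(\ell)\ominus\alpha$ and $W_{S_1}(\ell')$ by $W_{S_1}(\ell')\oplus\alpha$ for all such $\ell'$, where $0\le\alpha\le W_{S_2}(\ell)$. For a CFN $N$, $\mathrm{Bool}(N)$ is the constraint network with the same variables and domains and, for each cost function of nonempty scope, the constraint forbidding exactly the tuples of nonzero cost. $N$ is *virtual arc consistent* (VAC) if the (generalized) arc consistent closure of $\mathrm{Bool}(N)$ has no empty domain. A network $N'$ is a *result of enforcing VAC on $N$* if it is obtained from $N$ by a finite sequence of EPTs and either $N'$ is VAC or its constant satisfies $W_\varnothing=\top$ (infeasibility is proved). **Theorem.** Let $g$ be a cost function whose scope is a finite set $S$ of at least two variables. Suppose that $g$ decomposes into a Berge-acyclic CFN $N=(S\cup E,\mathcal F,\top)$, that is, $S\cap E=\varnothing$ and for every tuple $\ell$ over $S$, $g(\ell)$ is the minimum cost in $N$ of the assignments of $S\cup E$ that extend $\ell$. Let $W_x$, $x\in S$, be arbitrary unary cost functions, and put $$N_1=(S\cup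 E,\ \mathcal F\cup\{W_x\}_{x\in S},\ \top),\qquad N_2=(S,\ \{g\}\cup\{W_x\}_{x\in S},\ \top).$$ Then $N_1$ and $N_2$ have the same optimal cost $w$; VAC can be enforced on $N_1$ and on $N_2$; and every result of enforcing VAC on $N_1$, and every result of enforcing VAC on $N_2$, has the lower bound $W_\varnothing=w$. -/

import Mathlib

/-! Cost function networks, equivalence preserving transformations and virtual arc consistency.
Costs are taken in `[0, T]`, where `T : WithTop K` is finite or infinite, and `K` is an ordered
monoid of nonnegative finite costs, such as `ℕ` or `ℚ≥0`. -/

section CostStructure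

variable {K : Type*} [AddCommMonoid K] [LinearOrder K] [IsOrderedCancelAddMonoid K]
  [CanonicallyOrderedAdd K] [Sub K] [OrderedSub K]

/-- The costs `[0, …, T]`. -/
@[ext]
structure Cost (T : WithTop K) where
  val : WithTop K
  val_le : val ≤ T

namespace Cost

variable {T : WithTop K}

noncomputable instance : LinearOrder (Cost T) :=
  LinearOrder.lift' Cost.val fun _ _ => Cost.ext

instance : Zero (Cost T) := ⟨⟨0, zero_le⟩⟩

/-- The intolerable cost `T` itself. -/
instance : Top (Cost T) := ⟨⟨T, le_rfl⟩⟩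

/-- `a ⊕ b = min (T, a + b)`. -/
noncomputable def oplus (a b : Cost T) : Cost T := ⟨min T (a.val + b.val), min_le_left _ _⟩

/-- The sum of a finite family of costs with respect to `⊕`, that is, the sum capped at `T`. -/
noncomputable def bigOplus {J : Type*} [Fintype J] (f : J → Cost T) : Cost T :=
  ⟨min T (∑ j, (f j).val), min_le_left _ _⟩

open Classical in
/-- `a ⊖ b` is `a - b` if `a ≠ T`, and `T` if `a = T`; it is only used for `b ≤ a`. -/
noncomputable def ominus (a b : Cost T) : Cost T :=
  if a = ⊤ then ⊤ else
    ⟨((a.val.untopD 0 - b.val.untopD 0 : K) : WithTop K), by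
      refine le_trans ?_ a.val_le
      obtain ⟨a, ha⟩ := a
      induction a with
      | top => exact le_top
      | coe a => exact WithTop.coe_le_coe.2 tsub_le_self⟩

end Cost

end CostStructure

section Networks

/-- The tuples over a set `A` of variables, the variable `x` having domain `D x`. -/
abbrev Tuple {X : Type*} (D : X → Type*) (A : Finset X) : Type _ := ∀ x : A, D x.1

/-- The projection `ℓ[B]` of a tuple `ℓ` over `A ⊇ B`. -/
def Tuple.proj {X : Type*} {D : X → Type*} {A B : Finset X} (h : B ⊆ A) (ℓ : Tuple D A) :
    Tuple D B := fun x => ℓ ⟨x.1, h x.2⟩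

/-- The scopes of all the cost functions of a network whose cost functions of arity at least two
have the scopes `scope i`: there is also one cost function of empty scope (index `none`) and
one unary cost function for every variable `x` (index `some x`). -/
def fullScope {X ι : Type*} (scope : ι → Finset X) : Option X ⊕ ι → Finset X
  | .inl none => ∅
  | .inl (some x) => {x}
  | .inr i => scope i

/-- The incidence graph of the hypergraph with vertex set `X` and hyperedges `e j`. -/
def incidenceGraph {X J : Type*} (e : J → Finset X) : SimpleGraph (X ⊕ J) :=
  SimpleGraph.fromRel fun a b => ∃ x j, a = Sum.inl x ∧ b = Sum.inr j ∧ x ∈ e j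

/-- A classical constraint network: the constraint `c` allows the tuples in `rel c`. -/
structure ConstraintNetwork {X : Type*} (D : X → Type*) (C : Type*) where
  scope : C → Finset X
  rel : ∀ c, Set (Tuple D (scope c))

namespace ConstraintNetwork

variable {X C : Type*} {D : X → Type*}

/-- The subdomains `A x ⊆ D x` are (generalized) arc consistent: every value that is kept has,
in every constraint on its variable, a support made of values that are kept. -/
def IsArcConsistent (P : ConstraintNetwork D C) (A : ∀ x, Set (D x)) : Prop :=
  ∀ (c : C) (x : P.scope c), ∀ v ∈ A x.1,
    ∃ ℓ ∈ P.rel c, ℓ x = v ∧ ∀ y : P.scope c, ℓ y ∈ A y.1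

/-- The domains of the arc consistent closure: the largest arc consistent subdomains. -/
def acClosure (P : ConstraintNetwork D C) (x : X) : Set (D x) :=
  {v | ∃ A : ∀ y, Set (D y), P.IsArcConsistent A ∧ v ∈ A x}

end ConstraintNetwork

variable {K : Type*} [AddCommMonoid K] [LinearOrder K] [IsOrderedCancelAddMonoid K]
  [CanonicallyOrderedAdd K] [Sub K] [OrderedSub K]

/-- A cost function network `(X, {W_∅} ∪ {W_x | x ∈ X} ∪ {W_i | i ∈ ι}, T)`, where `W_i` has
the scope `scope i` with at least two variables. -/
structure CFN {X ι : Type*} (T : WithTop K) (D : X → Type*) (scope : ι → Finset X) where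
  two_le_card : ∀ i, 2 ≤ (scope i).card
  W : ∀ j : Option X ⊕ ι, Tuple D (fullScope scope j) → Cost T

namespace CFN

variable {X ι : Type*} {T : WithTop K} {D : X → Type*} {scope : ι → Finset X}

/-- The constant `W_∅`. -/
def lowerBound (N : CFN T D scope) : Cost T :=
  N.W (Sum.inl none) fun x => absurd x.2 (Finset.notMem_empty x.1)

/-- The cost of a complete assignment. -/
noncomputable def cost [Fintype X] [Fintype ι] (N : CFN T D scope) (ℓ : ∀ x, D x) : Cost T :=
  Cost.bigOplus fun j => N.W j fun x => ℓ x.1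

/-- `w` is the optimal cost of the network, the minimum of the costs of its assignments. -/
def IsOptimalCost [Fintype X] [Fintype ι] (N : CFN T D scope) (w : Cost T) : Prop :=
  IsLeast (Set.range N.cost) w

/-- The hypergraph of the network has an acyclic incidence graph. -/
def IsBergeAcyclic (_N : CFN T D scope) : Prop :=
  (incidenceGraph (fullScope scope)).IsAcyclic

open Classical in
/-- The cost `α` is moved from the cost function `i` to the tuple `ℓ` of the cost function `j`. -/
noncomputable def project (N : CFN T D scope) (i j : Option X ⊕ ι)
    (h : fullScope scope j ⊂ fullScope scope i) (ℓ : Tuple D (fullScope scope j)) (α : Cost T) :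
    CFN T D scope where
  two_le_card := N.two_le_card
  W := Function.update
    (Function.update N.W j (Function.update (N.W j) ℓ ((N.W j ℓ).oplus α))) i
    fun m => if Tuple.proj h.1 m = ℓ then (N.W i m).ominus α else N.W i m

open Classical in
/-- The cost `α` is moved from the tuple `ℓ` of the cost function `j` to the cost function `i`. -/
noncomputable def extend (N : CFN T D scope) (i j : Option X ⊕ ι)
    (h : fullScope scope j ⊂ fullScope scope i) (ℓ : Tuple D (fullScope scope j)) (α : Cost T) :
    CFN T D scope where
  two_le_card := N.two_le_card
  W := Function.update
    (Function.update N.W j (Function.update (N.W j) ℓ ((N.W j ℓ).ominus α))) i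
    fun m => if Tuple.proj h.1 m = ℓ then (N.W i m).oplus α else N.W i m

/-- The `r`-EPTs with `r ≤ 1`. A shift by a signed cost is a projection by a nonnegative cost or
an extension by a nonnegative cost; the preconditions keep all costs nonnegative. -/
inductive EPT : CFN T D scope → CFN T D scope → Prop
  | projection (N : CFN T D scope) (i j : Option X ⊕ ι)
      (h : fullScope scope j ⊂ fullScope scope i) (hj : (fullScope scope j).card ≤ 1)
      (ℓ : Tuple D (fullScope scope j)) (α : Cost T)
      (hα : ∀ m, Tuple.proj h.1 m = ℓ → α ≤ N.W i m) : EPT N (N.project i j h ℓ α)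
  | extension (N : CFN T D scope) (i j : Option X ⊕ ι)
      (h : fullScope scope j ⊂ fullScope scope i) (hj : (fullScope scope j).card ≤ 1)
      (ℓ : Tuple D (fullScope scope j)) (α : Cost T)
      (hα : α ≤ N.W j ℓ) : EPT N (N.extend i j h ℓ α)

/-- `Bool(N)`: for each cost function of nonempty scope, the constraint that forbids exactly the
tuples of nonzero cost. -/
def toBool (N : CFN T D scope) :
    ConstraintNetwork D {j : Option X ⊕ ι // (fullScope scope j).Nonempty} where
  scope j := fullScope scope j.1
  rel j := {ℓ | N.W j.1 ℓ = 0}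

/-- Virtual arc consistency: in the arc consistent closure of `Bool(N)` no domain is empty. -/
def IsVAC (N : CFN T D scope) : Prop := ∀ x, (N.toBool.acClosure x).Nonempty

/-- `N'` is a possible result of enforcing VAC on `N`: it is obtained from `N` by a finite sequence
of EPTs, and either it is VAC or its lower bound `W_∅ = T` shows that there is no feasible
assignment. (The second case is needed, because `T ⊖ α = T`: if, say, some `W_x` is constantly
`T`, then it remains so under all EPTs.) -/
def EnforcesVAC (N N' : CFN T D scope) : Prop :=
  Relation.ReflTransGen EPT N N' ∧ (N'.IsVAC ∨ N'.lowerBound = ⊤)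

end CFN

section Decomposition

variable {S E ι : Type*} {T : WithTop K} {D : S ⊕ E → Type*} {scope : ι → Finset (S ⊕ E)}

/-- The network `N` on the variables `S ∪ E` is a network decomposition of the cost function
`g` of scope `S`: the cost `g ℓ` is the minimum cost of the extensions of `ℓ` to `S ∪ E`. -/
def IsNetworkDecomposition [Fintype S] [Fintype E] [Fintype ι]
    (g : (∀ s : S, D (Sum.inl s)) → Cost T) (N : CFN T D scope) : Prop :=
  ∀ ℓ, IsLeast (N.cost '' {ℓ' | ∀ s, ℓ' (Sum.inl s) = ℓ s}) (g ℓ)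

/-- The network `(S ∪ E, F ∪ {W_s | s ∈ S}, T)`, where `F` are the cost functions of `N`, and
`W_s = u s`. If `F` has a unary cost function on `s` already, then `u s` is added to it. -/
noncomputable def CFN.addUnary (N : CFN T D scope) (u : ∀ s : S, D (Sum.inl s) → Cost T) :
    CFN T D scope where
  two_le_card := N.two_le_card
  W := fun j => match j with
    | .inl none => N.W (.inl none)
    | .inl (some (.inl s)) => fun ℓ => (N.W (.inl (some (.inl s))) ℓ).oplus
        (u s (ℓ ⟨.inl s, Finset.mem_singleton_self _⟩))
    | .inl (some (.inr e)) => N.W (.inl (some (.inr e)))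
    | .inr i => N.W (.inr i)

/-- The network `(S, {g} ∪ {W_s | s ∈ S}, T)`, where `g` has the scope `S`, and `W_s = u s`. -/
def CFN.ofGlobal {S : Type*} [Fintype S] {DS : S → Type*} (hS : 2 ≤ Fintype.card S)
    (g : (∀ s, DS s) → Cost T) (u : ∀ s, DS s → Cost T) :
    CFN T DS (fun _ : Unit => (Finset.univ : Finset S)) where
  two_le_card := fun _ => hS
  W := fun j => match j with
    | .inl none => fun _ => 0
    | .inl (some s) => fun ℓ => u s (ℓ ⟨s, Finset.mem_singleton_self _⟩)
    | .inr () => fun ℓ => g fun s => ℓ ⟨s, Finset.mem_univ s⟩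

end Decomposition

end Networks

/-! An EPT preserves the cost of every assignment, so the constant of any network reached from `N`
is at most the optimum of `N`. If the network reached is VAC, this bound is attained: when the
hyperedges can be removed leaf by leaf, arc consistent nonempty subdomains contain a solution of
`Bool` (`exists_solution_of_isArcConsistent`), and the only cost that a solution pays is `W_∅`. If
instead `W_∅ = ⊤`, every assignment costs `⊤`. So every result of enforcing VAC has the optimal cost
as its constant (`EnforcesVAC.isOptimalCost_lowerBound`). The two optima agree because minimising
over `E` first turns the decomposition into `g`. Acyclicity enters only through `IsLeafEliminable`,
which the single hyperedge `g` satisfies trivially.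

That VAC can be enforced is shown by an explicit elimination. In each leaf hyperedge, the unary
costs of all variables but the attachment vertex are extended into it, and its minima are then
projected to the attachment vertex; at the end the unary minima go to the constant. Unless the
constant becomes `⊤`, values of cost zero can be traced back from the roots to the leaves, giving an
assignment on which all nonconstant costs vanish (`exists_reachesOn_forall_exists_solution`,
`exists_enforcesVAC`).

The delicate point is `⊤ ⊖ α = ⊤`: a cost `⊤` can never be removed, so supports are only obtained
for values of finite cost. Conversely, a cost that is finite after some EPTs was finite before them
(`eq_top_of_reaches`). -/

set_option linter.unusedSectionVars false

/-! ### Leaves of acyclic hypergraphs -/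

section LeafElimination

/-- In a finite acyclic graph, every nonempty set of vertices has a member with at most one
neighbour in the set. -/
theorem SimpleGraph.IsAcyclic.exists_mem_neighbors_subsingleton {V : Type*} [Finite V]
    {G : SimpleGraph V} (hG : G.IsAcyclic) {s : Set V} (hs : s.Nonempty) :
    ∃ v ∈ s, ∀ a ∈ s, ∀ b ∈ s, G.Adj v a → G.Adj v b → a = b := by
  classical
  have : Nonempty s := hs.to_subtype
  have hH : (G.induce s).IsAcyclic := hG.induce s
  -- The end of a longest path works: a neighbour of `v` other than the penultimate vertex would
  -- either prolong the path or close a cycle.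
  obtain ⟨u, v, p, hp, hmax⟩ := SimpleGraph.Walk.exists_isPath_forall_isPath_length_le_length (G.induce s)
  have key : ∀ a, (G.induce s).Adj v a → a = p.penultimate := by
    intro a ha
    apply hH.eq_penultimate_of_adj_end hp ha
    by_contra hmem
    have := hmax _ _ _ (hp.concat hmem ha)
    rw [SimpleGraph.Walk.length_concat] at this
    omega
  refine ⟨v, v.2, fun a ha b hb hva hvb => ?_⟩
  have h1 := key ⟨a, ha⟩ hva
  have h2 := key ⟨b, hb⟩ hvb
  exact congrArg Subtype.val (h1.trans h2.symm)

/-- Every nonempty set of hyperedges has a member that meets the other members of the set in at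
most one vertex. -/
def IsLeafEliminable {X ι : Type*} (scope : ι → Finset X) : Prop :=
  ∀ F : Finset ι, F.Nonempty → ∃ e ∈ F, ∃ x ∈ scope e,
    ∀ y ∈ scope e, y ≠ x → ∀ i ∈ F, i ≠ e → y ∉ scope i

theorem isLeafEliminable_of_subsingleton {X ι : Type*} [Subsingleton ι] {scope : ι → Finset X}
    (h : ∀ i, (scope i).Nonempty) : IsLeafEliminable scope := by
  rintro F ⟨e, he⟩
  obtain ⟨x, hx⟩ := h e
  exact ⟨e, he, x, hx, fun y _ _ i _ hie => absurd (Subsingleton.elim i e) hie⟩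

/-- In the incidence graph, consider the members of `F` together with the vertices shared by two of
them. A shared vertex has two neighbours in this set, so a node with at most one neighbour must be a
hyperedge, and it meets the others in at most one vertex. -/
theorem isLeafEliminable_of_isAcyclic {X ι : Type*} [Finite X] [Finite ι] {scope : ι → Finset X}
    (h : ∀ i, (scope i).Nonempty) (hG : (incidenceGraph (fullScope scope)).IsAcyclic) :
    IsLeafEliminable scope := by
  rintro F ⟨e₀, he₀⟩
  have hadj : ∀ x i, x ∈ scope i →
      (incidenceGraph (fullScope scope)).Adj (.inr (.inr i)) (.inl x) := by
    intro x i hx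
    rw [incidenceGraph, SimpleGraph.fromRel_adj]
    exact ⟨by simp, Or.inr ⟨x, .inr i, rfl, rfl, hx⟩⟩
  let s : Set (X ⊕ (Option X ⊕ ι)) := {v | (∃ i ∈ F, v = .inr (.inr i)) ∨
    ∃ x, ∃ i ∈ F, ∃ j ∈ F, i ≠ j ∧ x ∈ scope i ∧ x ∈ scope j ∧ v = .inl x}
  obtain ⟨v, hv, huniq⟩ := hG.exists_mem_neighbors_subsingleton (s := s)
    ⟨_, Or.inl ⟨e₀, he₀, rfl⟩⟩
  rcases hv with ⟨e, he, rfl⟩ | ⟨x, i, hi, j, hj, hij, hxi, hxj, rfl⟩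
  · refine ⟨e, he, ?_⟩
    have hshared : ∀ y ∈ scope e, ∀ i ∈ F, i ≠ e → y ∈ scope i → (Sum.inl y) ∈ s :=
      fun y hy i hi hie hyi => Or.inr ⟨y, i, hi, e, he, hie, hyi, hy, rfl⟩
    by_cases hx : ∃ x ∈ scope e, ∃ i ∈ F, i ≠ e ∧ x ∈ scope i
    · obtain ⟨x, hxe, i, hi, hie, hxi⟩ := hx
      refine ⟨x, hxe, fun y hy hyx j hj hje hyj => hyx ?_⟩
      exact Sum.inl_injective (huniq _ (hshared y hy j hj hje hyj) _ (hshared x hxe i hi hie hxi)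
        (hadj _ _ hy) (hadj _ _ hxe))
    · obtain ⟨x, hxe⟩ := h e
      exact ⟨x, hxe, fun y hy _ i hi hie hyi => hx ⟨y, hy, i, hi, hie, hyi⟩⟩
  · have := huniq _ (Or.inl ⟨i, hi, rfl⟩) _ (Or.inl ⟨j, hj, rfl⟩)
      (hadj _ _ hxi).symm (hadj _ _ hxj).symm
    exact absurd (Sum.inr_injective (Sum.inr_injective this)) hij

end LeafElimination

/-! ### Arithmetic of capped costs -/

section CostLemmas

variable {K : Type*} [AddCommMonoid K] [LinearOrder K] [IsOrderedCancelAddMonoid K]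
  [CanonicallyOrderedAdd K] [Sub K] [OrderedSub K] {T : WithTop K}

namespace Cost

theorem le_def {a b : Cost T} : a ≤ b ↔ a.val ≤ b.val := Iff.rfl

@[simp] theorem val_top : (⊤ : Cost T).val = T := rfl

@[simp] theorem val_zero : (0 : Cost T).val = 0 := rfl

@[simp] theorem val_oplus (a b : Cost T) : (a.oplus b).val = min T (a.val + b.val) := rfl

@[simp] theorem val_bigOplus {J : Type*} [Fintype J] (f : J → Cost T) :
    (bigOplus f).val = min T (∑ j, (f j).val) := rfl

theorem le_top' (a : Cost T) : a ≤ ⊤ := a.val_le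

theorem zero_ne_top (hT : 0 < T) : (0 : Cost T) ≠ ⊤ := fun h => hT.ne (congrArg val h)

theorem top_oplus (a : Cost T) : (⊤ : Cost T).oplus a = ⊤ :=
  Cost.ext (min_eq_left (le_add_of_nonneg_right zero_le))

theorem oplus_comm (a b : Cost T) : a.oplus b = b.oplus a :=
  Cost.ext (by simp [add_comm])

theorem oplus_top (a : Cost T) : a.oplus ⊤ = ⊤ := by rw [oplus_comm, top_oplus]

theorem top_ominus (a : Cost T) : (⊤ : Cost T).ominus a = ⊤ := if_pos rfl

theorem val_ne_top {a : Cost T} (ha : a ≠ ⊤) : a.val ≠ ⊤ := fun h =>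
  ha (Cost.ext (le_antisymm a.val_le (h ▸ le_top)))

theorem val_ominus_add {a b : Cost T} (ha : a ≠ ⊤) (hb : b ≤ a) :
    (a.ominus b).val + b.val = a.val := by
  have ha' := val_ne_top ha
  have hb' : b.val ≠ ⊤ := ne_top_of_le_ne_top ha' hb
  rw [ominus, if_neg ha]
  rw [le_def] at hb
  obtain ⟨a, hat⟩ := a
  obtain ⟨b, hbt⟩ := b
  lift a to K using ha'
  lift b to K using hb'
  simp only [WithTop.untopD_coe]
  rw [← WithTop.coe_add, tsub_add_cancel_of_le (WithTop.coe_le_coe.1 hb)]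

theorem ominus_oplus {a b : Cost T} (hb : b ≤ a) : (a.ominus b).oplus b = a := by
  by_cases ha : a = ⊤
  · rw [ha, top_ominus, top_oplus]
  · exact Cost.ext (by rw [val_oplus, val_ominus_add ha hb, min_eq_right a.val_le])

theorem ominus_self {a : Cost T} (ha : a ≠ ⊤) : a.ominus a = 0 := by
  have h := val_ominus_add ha le_rfl
  have ha' := val_ne_top ha
  refine Cost.ext ?_
  exact (WithTop.add_right_inj ha').1 (by rw [h, val_zero, zero_add])

theorem zero_ominus (hT : 0 < T) (a : Cost T) : (0 : Cost T).ominus a = 0 := by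
  refine Cost.ext ?_
  rw [ominus, if_neg (zero_ne_top hT)]
  simp

theorem oplus_mono {a b c d : Cost T} (h : a ≤ b) (h' : c ≤ d) : a.oplus c ≤ b.oplus d :=
  le_def.2 (min_le_min le_rfl (add_le_add h h'))

/-- Inner caps may be dropped under an outer one, which reduces identities for `⊕` to identities for
`+`. -/
theorem min_add_min (x y : WithTop K) : min T (min T x + y) = min T (x + y) := by
  rcases le_total T x with h | h
  · rw [min_eq_left h, min_eq_left (le_add_of_nonneg_right zero_le),
      min_eq_left (h.trans (le_add_of_nonneg_right zero_le))]
  · rw [min_eq_right h]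

theorem oplus_assoc (a b c : Cost T) : (a.oplus b).oplus c = a.oplus (b.oplus c) := by
  refine Cost.ext ?_
  simp only [val_oplus]
  rw [min_add_min, add_comm a.val (min T _), min_add_min, add_comm _ a.val, add_assoc]

/-- Moving `c` from the first to the second summand does not change the sum. -/
theorem ominus_oplus_oplus {a b c : Cost T} (h : c ≤ a) :
    (a.ominus c).oplus (b.oplus c) = a.oplus b := by
  rw [oplus_comm b, ← oplus_assoc, ominus_oplus h]

section BigOplus

variable {J : Type*} [Fintype J]

/-- An EPT changes two cost functions only, so their two terms are isolated from the total. -/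
theorem bigOplus_eq_oplus_oplus [DecidableEq J] (f : J → Cost T) {i j : J} (hij : i ≠ j) :
    (bigOplus f).val =
      min T (((f i).oplus (f j)).val + ∑ k ∈ (Finset.univ.erase i).erase j, (f k).val) := by
  rw [val_bigOplus, val_oplus, min_add_min, add_assoc,
    Finset.add_sum_erase _ (fun k => (f k).val) (by simp [hij.symm]),
    Finset.add_sum_erase _ (fun k => (f k).val) (Finset.mem_univ _)]

theorem bigOplus_congr_pair {f f' : J → Cost T} {i j : J} (hij : i ≠ j)
    (h : ∀ k, k ≠ i → k ≠ j → f k = f' k) (h' : (f i).oplus (f j) = (f' i).oplus (f' j)) :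
    bigOplus f = bigOplus f' := by
  classical
  refine Cost.ext ?_
  rw [bigOplus_eq_oplus_oplus f hij, bigOplus_eq_oplus_oplus f' hij, h']
  congr 2
  refine Finset.sum_congr rfl fun k hk => ?_
  simp only [Finset.mem_erase] at hk
  rw [h k hk.2.1 hk.1]

theorem le_bigOplus (f : J → Cost T) (i : J) : f i ≤ bigOplus f :=
  le_def.2 (le_min (f i).val_le
    (Finset.single_le_sum (f := fun j => (f j).val) (fun _ _ => zero_le) (Finset.mem_univ i)))

theorem bigOplus_eq_single (f : J → Cost T) (i : J) (h : ∀ j, j ≠ i → f j = 0) :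
    bigOplus f = f i := by
  refine Cost.ext ?_
  rw [val_bigOplus, Finset.sum_eq_single i (fun j _ hj => by rw [h j hj, val_zero]) (by simp),
    min_eq_right (f i).val_le]

end BigOplus

end Cost

end CostLemmas

/-! ### Invariants of EPTs, and optimality of the constant under VAC -/

section Networks

variable {K : Type*} [AddCommMonoid K] [LinearOrder K] [IsOrderedCancelAddMonoid K]
  [CanonicallyOrderedAdd K] [Sub K] [OrderedSub K] {T : WithTop K}
  {X ι : Type*} {D : X → Type*} {scope : ι → Finset X}

theorem index_ne_of_ssubset {i j : Option X ⊕ ι} (h : fullScope scope j ⊂ fullScope scope i) :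
    i ≠ j := fun hij => h.ne (congrArg _ hij.symm)

theorem singleton_subset_fullScope {i : ι} {x : X} (hx : x ∈ scope i) :
    fullScope scope (.inl (some x)) ⊆ fullScope scope (.inr i) :=
  Finset.singleton_subset_iff.2 hx

theorem empty_ssubset_fullScope (x : X) :
    fullScope scope (.inl none) ⊂ fullScope scope (.inl (some x)) :=
  Finset.empty_ssubset.2 (Finset.singleton_nonempty x)

theorem unaryTuple_ext {x : X} {t t' : Tuple D (fullScope scope (.inl (some x)))}
    (h : t ⟨x, Finset.mem_singleton_self x⟩ = t' ⟨x, Finset.mem_singleton_self x⟩) : t = t' := by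
  funext ⟨y, hy⟩
  obtain rfl : y = x := Finset.mem_singleton.1 hy
  exact h

instance : Subsingleton (Tuple D (fullScope scope (.inl none))) :=
  ⟨fun _ _ => funext fun x => absurd x.2 (Finset.notMem_empty x.1)⟩

/-- A tuple over a leaf hyperedge can be combined with an assignment that agrees with it in the
attachment vertex, without changing the projections to the other hyperedges. -/
theorem exists_override {F : Finset ι} {e : ι} {x : X}
    (hleaf : ∀ y ∈ scope e, y ≠ x → ∀ i ∈ F, i ≠ e → y ∉ scope i)
    (ℓ : ∀ x, D x) (m : Tuple D (scope e)) (hm : ∀ hx : x ∈ scope e, m ⟨x, hx⟩ = ℓ x) :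
    ∃ ℓ' : ∀ x, D x, (scope e).restrict ℓ' = m ∧
      (∀ y, (∃ hy : y ∈ scope e, ℓ' y = m ⟨y, hy⟩) ∨ ℓ' y = ℓ y) ∧
      ∀ i ∈ F, i ≠ e → (scope i).restrict ℓ' = (scope i).restrict ℓ := by
  classical
  refine ⟨fun y => if hy : y ∈ scope e then m ⟨y, hy⟩ else ℓ y, ?_, ?_, ?_⟩
  · funext y
    exact dif_pos y.2
  · intro y
    by_cases hy : y ∈ scope e
    · exact Or.inl ⟨hy, dif_pos hy⟩
    · exact Or.inr (dif_neg hy)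
  · intro i hi hie
    funext ⟨y, hyi⟩
    by_cases hy : y ∈ scope e
    · obtain rfl : y = x := by
        by_contra hyx
        exact hleaf y hy hyx i hi hie hyi
      exact (dif_pos hy).trans (hm hy)
    · exact dif_neg hy

namespace CFN

theorem cost_def [Fintype X] [Fintype ι] (N : CFN T D scope) (ℓ : ∀ x, D x) :
    N.cost ℓ = Cost.bigOplus fun j => N.W j ((fullScope scope j).restrict ℓ) := rfl

section Transformations

variable {N : CFN T D scope} {i j : Option X ⊕ ι} {h : fullScope scope j ⊂ fullScope scope i}
  {ℓ : Tuple D (fullScope scope j)} {α : Cost T}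

open Classical in
theorem project_W_source (m : Tuple D (fullScope scope i)) : (N.project i j h ℓ α).W i m =
    if Tuple.proj h.1 m = ℓ then (N.W i m).ominus α else N.W i m := by
  simp only [project, Function.update_self]

open Classical in
theorem project_W_target :
    (N.project i j h ℓ α).W j = Function.update (N.W j) ℓ ((N.W j ℓ).oplus α) := by
  simp only [project, Function.update_of_ne (index_ne_of_ssubset h).symm, Function.update_self]

open Classical in
theorem project_W_of_ne {k : Option X ⊕ ι} (hi : k ≠ i) (hj : k ≠ j) :
    (N.project i j h ℓ α).W k = N.W k := by
  simp only [project, Function.update_of_ne hi, Function.update_of_ne hj]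

open Classical in
theorem extend_W_source (m : Tuple D (fullScope scope i)) : (N.extend i j h ℓ α).W i m =
    if Tuple.proj h.1 m = ℓ then (N.W i m).oplus α else N.W i m := by
  simp only [extend, Function.update_self]

open Classical in
theorem extend_W_target :
    (N.extend i j h ℓ α).W j = Function.update (N.W j) ℓ ((N.W j ℓ).ominus α) := by
  simp only [extend, Function.update_of_ne (index_ne_of_ssubset h).symm, Function.update_self]

open Classical in
theorem extend_W_of_ne {k : Option X ⊕ ι} (hi : k ≠ i) (hj : k ≠ j) :
    (N.extend i j h ℓ α).W k = N.W k := by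
  simp only [extend, Function.update_of_ne hi, Function.update_of_ne hj]

end Transformations

/-- On an assignment that extends `ℓ`, the amount `α` leaves one summand and enters another; on all
other assignments no summand changes. -/
theorem EPT.cost_eq [Fintype X] [Fintype ι] {N N' : CFN T D scope} (h : EPT N N') :
    N'.cost = N.cost := by
  classical
  funext L
  cases h with
  | projection i j h hj ℓ α hα =>
    refine Cost.bigOplus_congr_pair (index_ne_of_ssubset h)
      (fun k hi hj => by rw [project_W_of_ne hi hj]) ?_
    rw [project_W_source, project_W_target]
    by_cases hℓ : Tuple.proj h.1 ((fullScope scope i).restrict L) = ℓ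
    · subst hℓ
      refine (congrArg₂ _ (if_pos rfl) (Function.update_self _ _ _)).trans ?_
      exact Cost.ominus_oplus_oplus (hα _ rfl)
    · exact congrArg₂ _ (if_neg hℓ) (Function.update_of_ne hℓ _ _)
  | extension i j h hj ℓ α hα =>
    refine Cost.bigOplus_congr_pair (index_ne_of_ssubset h)
      (fun k hi hj => by rw [extend_W_of_ne hi hj]) ?_
    rw [extend_W_source, extend_W_target]
    by_cases hℓ : Tuple.proj h.1 ((fullScope scope i).restrict L) = ℓ
    · subst hℓ
      refine (congrArg₂ _ (if_pos rfl) (Function.update_self _ _ _)).trans ?_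
      rw [Cost.oplus_comm, Cost.ominus_oplus_oplus hα, Cost.oplus_comm]
      rfl
    · exact congrArg₂ _ (if_neg hℓ) (Function.update_of_ne hℓ _ _)

/-- `⊤` absorbs both `⊕` and `⊖`. The contrapositive carries finiteness back to earlier networks. -/
theorem EPT.eq_top {N N' : CFN T D scope} (h : EPT N N') {k : Option X ⊕ ι}
    {m : Tuple D (fullScope scope k)} (hm : N.W k m = ⊤) : N'.W k m = ⊤ := by
  classical
  cases h with
  | projection i j h hj ℓ α hα =>
    by_cases hki : k = i
    · subst hki
      rw [project_W_source, hm, Cost.top_ominus, ite_self]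
    by_cases hkj : k = j
    · subst hkj
      rw [project_W_target, Function.update_apply]
      split_ifs with hmℓ
      · rw [← hmℓ, hm, Cost.top_oplus]
      · exact hm
    · rwa [project_W_of_ne hki hkj]
  | extension i j h hj ℓ α hα =>
    by_cases hki : k = i
    · subst hki
      rw [extend_W_source, hm, Cost.top_oplus, ite_self]
    by_cases hkj : k = j
    · subst hkj
      rw [extend_W_target, Function.update_apply]
      split_ifs with hmℓ
      · rw [← hmℓ, hm, Cost.top_ominus]
      · exact hm
    · rwa [extend_W_of_ne hki hkj]

theorem cost_eq_of_reaches [Fintype X] [Fintype ι] {N N' : CFN T D scope}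
    (h : Relation.ReflTransGen EPT N N') : N'.cost = N.cost := by
  induction h with
  | refl => rfl
  | tail _ h ih => rw [h.cost_eq, ih]

theorem eq_top_of_reaches {N N' : CFN T D scope} (h : Relation.ReflTransGen EPT N N')
    {k : Option X ⊕ ι} {m : Tuple D (fullScope scope k)} (hm : N.W k m = ⊤) : N'.W k m = ⊤ := by
  induction h with
  | refl => exact hm
  | tail _ h ih => exact h.eq_top ih

theorem lowerBound_le_cost [Fintype X] [Fintype ι] (N : CFN T D scope) (ℓ : ∀ x, D x) :
    N.lowerBound ≤ N.cost ℓ := by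
  refine le_of_eq_of_le ?_ (Cost.le_bigOplus _ (.inl none))
  exact congrArg (N.W (.inl none)) (Subsingleton.elim _ _)

theorem isArcConsistent_acClosure {C : Type*} (P : ConstraintNetwork D C) :
    P.IsArcConsistent P.acClosure := by
  rintro c x v ⟨A, hA, hv⟩
  obtain ⟨ℓ, hℓ, hx, hy⟩ := hA c x v hv
  exact ⟨ℓ, hℓ, hx, fun y => ⟨A, hA, hy y⟩⟩

/-- In a network without cycles, arc consistent subdomains contain a solution. -/
theorem exists_solution_of_isArcConsistent (N : CFN T D scope) (hs : IsLeafEliminable scope)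
    {A : ∀ x, Set (D x)} (hA : N.toBool.IsArcConsistent A) (hne : ∀ x, (A x).Nonempty)
    (F : Finset ι) : ∃ ℓ : ∀ x, D x, (∀ x, ℓ x ∈ A x) ∧
      ∀ i ∈ F, N.W (.inr i) ((scope i).restrict ℓ) = 0 := by
  classical
  induction F using Finset.strongInduction with
  | H F ih =>
    rcases F.eq_empty_or_nonempty with rfl | hF
    · choose ℓ hℓ using hne
      exact ⟨ℓ, hℓ, by simp⟩
    obtain ⟨e, he, x, hx, hleaf⟩ := hs F hF
    obtain ⟨ℓ, hℓA, hℓ⟩ := ih (F.erase e) (Finset.erase_ssubset he)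
    -- The rest of `F` is already solved by `ℓ`. A support in the leaf `e` for the value `ℓ x` can
    -- overwrite `ℓ` there, since the other variables of `e` occur in no other member of `F`.
    obtain ⟨m, hm, hmx, hmA⟩ := hA ⟨.inr e, ⟨x, hx⟩⟩ ⟨x, hx⟩ (ℓ x) (hℓA x)
    obtain ⟨ℓ', h1, h2, h3⟩ := exists_override hleaf ℓ m fun _ => hmx
    refine ⟨ℓ', fun y => ?_, fun i hi => ?_⟩
    · rcases h2 y with ⟨hy, h⟩ | h
      · rw [h]
        exact hmA ⟨y, hy⟩
      · rw [h]
        exact hℓA y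
    · by_cases hie : i = e
      · subst hie
        rw [h1]
        exact hm
      · rw [h3 i hi hie]
        exact hℓ i (Finset.mem_erase.2 ⟨hie, hi⟩)

theorem IsVAC.exists_cost_eq_lowerBound [Fintype X] [Fintype ι] {N : CFN T D scope}
    (hs : IsLeafEliminable scope) (h : N.IsVAC) : ∃ ℓ, N.cost ℓ = N.lowerBound := by
  have hA := isArcConsistent_acClosure N.toBool
  obtain ⟨ℓ, hℓA, hℓ⟩ := N.exists_solution_of_isArcConsistent hs hA h Finset.univ
  refine ⟨ℓ, (Cost.bigOplus_eq_single _ (.inl none) ?_).trans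
    (congrArg (N.W (.inl none)) (Subsingleton.elim _ _))⟩
  rintro ((_ | x) | i) hj
  · exact absurd rfl hj
  · obtain ⟨m, hm, hmx, -⟩ := hA ⟨.inl (some x), ⟨x, Finset.mem_singleton_self x⟩⟩
      ⟨x, Finset.mem_singleton_self x⟩ (ℓ x) (hℓA x)
    refine (congrArg _ (unaryTuple_ext ?_)).trans hm
    exact hmx.symm
  · exact hℓ i (Finset.mem_univ i)

theorem EnforcesVAC.isOptimalCost_lowerBound [Fintype X] [Fintype ι] [∀ x, Nonempty (D x)]
    {N N' : CFN T D scope} (hs : IsLeafEliminable scope) (h : N.EnforcesVAC N') :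
    N.IsOptimalCost N'.lowerBound := by
  rw [IsOptimalCost, ← cost_eq_of_reaches h.1]
  refine ⟨?_, ?_⟩
  · rcases h.2 with h | h
    · exact h.exists_cost_eq_lowerBound hs
    · have ℓ : ∀ x, D x := fun x => Classical.arbitrary _
      exact ⟨ℓ, le_antisymm (h ▸ Cost.le_top' _) (N'.lowerBound_le_cost ℓ)⟩
  · rintro _ ⟨ℓ, rfl⟩
    exact N'.lowerBound_le_cost ℓ

/-- The singletons `{ℓ y}` are arc consistent subdomains, hence contained in the closure. -/
theorem isVAC_of_exists {N : CFN T D scope} (ℓ : ∀ x, D x)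
    (h : ∀ j, j ≠ .inl none → N.W j ((fullScope scope j).restrict ℓ) = 0) : N.IsVAC := by
  refine fun x => ⟨ℓ x, fun y => {ℓ y}, ?_, rfl⟩
  rintro ⟨j, hj⟩ y v rfl
  refine ⟨(fullScope scope j).restrict ℓ, h j ?_, rfl, fun y => rfl⟩
  rintro rfl
  exact Finset.not_nonempty_empty hj

end CFN

end Networks

/-- Finitely many goals can be reached one after the other if reaching one of them does not spoil
those that have been reached before. -/
theorem exists_rel_forall_of_step {α τ : Type*} [Finite τ] (R : α → α → Prop)
    (hrefl : ∀ a, R a a) (htrans : ∀ a b c, R a b → R b c → R a c) (P : τ → α → Prop)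
    (hstep : ∀ a t, ∃ b, R a b ∧ P t b ∧ ∀ t', t' ≠ t → P t' a → P t' b) (a : α) :
    ∃ b, R a b ∧ ∀ t, P t b := by
  classical
  have := Fintype.ofFinite τ
  suffices h : ∀ s : Finset τ, ∃ b, R a b ∧ ∀ t ∈ s, P t b by
    obtain ⟨b, hb, hP⟩ := h Finset.univ
    exact ⟨b, hb, fun t => hP t (Finset.mem_univ t)⟩
  intro s
  induction s using Finset.induction_on with
  | empty => exact ⟨a, hrefl a, by simp⟩
  | insert t s hts ih =>
    obtain ⟨b, hab, hb⟩ := ih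
    obtain ⟨c, hbc, hc, hkeep⟩ := hstep b t
    refine ⟨c, htrans a b c hab hbc, fun t' ht' => ?_⟩
    by_cases h : t' = t
    · rwa [h]
    · exact hkeep t' h (hb t' ((Finset.mem_insert.1 ht').resolve_left h))

/-! ### Enforcing VAC by leaf elimination -/

section Networks

variable {K : Type*} [AddCommMonoid K] [LinearOrder K] [IsOrderedCancelAddMonoid K]
  [CanonicallyOrderedAdd K] [Sub K] [OrderedSub K] {T : WithTop K}
  {X ι : Type*} {D : X → Type*} {scope : ι → Finset X}

theorem exists_proj_eq [∀ x, Nonempty (D x)] {A B : Finset X} (h : B ⊆ A) (t : Tuple D B) :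
    ∃ m : Tuple D A, Tuple.proj h m = t := by
  classical
  refine ⟨fun x => if hx : x.1 ∈ B then t ⟨x.1, hx⟩ else Classical.arbitrary _, ?_⟩
  funext x
  exact dif_pos x.2

/-- Some tuple has minimum cost among those that extend a given tuple. -/
theorem exists_proj_eq_isMin [∀ x, Finite (D x)] [∀ x, Nonempty (D x)] {A B : Finset X}
    (h : B ⊆ A) (t : Tuple D B) (f : Tuple D A → Cost T) :
    ∃ m : Tuple D A, Tuple.proj h m = t ∧ ∀ m', Tuple.proj h m' = t → f m ≤ f m' := by
  obtain ⟨m₀, hm₀⟩ := exists_proj_eq h t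
  have : Nonempty {m : Tuple D A // Tuple.proj h m = t} := ⟨⟨m₀, hm₀⟩⟩
  obtain ⟨m, hm⟩ := Finite.exists_min fun m : {m : Tuple D A // Tuple.proj h m = t} => f m.1
  exact ⟨m.1, m.2, fun m' hm' => hm ⟨m', hm'⟩⟩

namespace CFN

theorem singleton_ssubset_fullScope (N : CFN T D scope) {i : ι} {x : X} (hx : x ∈ scope i) :
    fullScope scope (.inl (some x)) ⊂ fullScope scope (.inr i) := by
  refine (singleton_subset_fullScope hx).ssubset_of_ne fun h => ?_
  have h1 : (scope i).card = 1 := (congrArg Finset.card h).symm.trans (Finset.card_singleton x)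
  have h2 := N.two_le_card i
  omega

/-- The network `N'` is obtained from `N` by EPTs, and only the cost functions in `J` differ. -/
def ReachesOn (J : Set (Option X ⊕ ι)) (N N' : CFN T D scope) : Prop :=
  Relation.ReflTransGen EPT N N' ∧ ∀ k ∉ J, N'.W k = N.W k

theorem ReachesOn.refl (J : Set (Option X ⊕ ι)) (N : CFN T D scope) : ReachesOn J N N :=
  ⟨.refl, fun _ _ => rfl⟩

theorem ReachesOn.trans {J : Set (Option X ⊕ ι)} {N₁ N₂ N₃ : CFN T D scope}
    (h : ReachesOn J N₁ N₂) (h' : ReachesOn J N₂ N₃) : ReachesOn J N₁ N₃ :=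
  ⟨h.1.trans h'.1, fun k hk => (h'.2 k hk).trans (h.2 k hk)⟩

theorem ReachesOn.mono {J J' : Set (Option X ⊕ ι)} {N N' : CFN T D scope} (hJ : J ⊆ J')
    (h : ReachesOn J N N') : ReachesOn J' N N' :=
  ⟨h.1, fun k hk => h.2 k fun hkJ => hk (hJ hkJ)⟩

/-- The unary costs of all variables of a hyperedge but one can be moved into the hyperedge. -/
theorem exists_reachesOn_extend [∀ x, Finite (D x)] (N : CFN T D scope) (e : ι) (x : X) :
    ∃ N', ReachesOn ({.inr e} ∪ {k | ∃ y ∈ scope e, y ≠ x ∧ k = .inl (some y)}) N N' ∧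
      ∀ m, N'.W (.inr e) m ≠ ⊤ → ∀ (y : X) (hy : y ∈ scope e), y ≠ x →
        N'.W (.inl (some y)) (Tuple.proj (singleton_subset_fullScope hy) m) = 0 := by
  classical
  let τ := Σ y : {y : X // y ∈ scope e ∧ y ≠ x}, Tuple D (fullScope scope (.inl (some y.1)))
  have : Finite {y : X // y ∈ scope e ∧ y ≠ x} :=
    Finite.of_injective (fun y => (⟨y.1, y.2.1⟩ : scope e)) fun a b h =>
      Subtype.ext (congrArg (fun z : scope e => z.1) h)
  refine Exists.imp ?_ <| exists_rel_forall_of_step (τ := τ)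
    (ReachesOn ({.inr e} ∪ {k | ∃ y ∈ scope e, y ≠ x ∧ k = .inl (some y)}))
    (fun N => ReachesOn.refl _ N) (fun _ _ _ => ReachesOn.trans)
    -- A unary cost `⊤` cannot be brought to zero, but extending it makes every tuple of `e` above
    -- it cost `⊤`; hence the alternative. Both alternatives survive the treatment of other values.
    (fun t M => M.W (.inl (some t.1.1)) t.2 = 0 ∨
      ∀ m, Tuple.proj (singleton_subset_fullScope t.1.2.1) m = t.2 → M.W (.inr e) m = ⊤) ?_ N
  · refine fun N' => And.imp_right fun hP m hm y hy hyx => ?_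
    exact (hP ⟨⟨y, hy, hyx⟩, Tuple.proj (singleton_subset_fullScope hy) m⟩).resolve_right
      fun h => hm (h m rfl)
  · rintro M ⟨⟨y, hy, hyx⟩, t⟩
    have hsub := M.singleton_ssubset_fullScope hy
    have hept : EPT M (M.extend (.inr e) (.inl (some y)) hsub t (M.W (.inl (some y)) t)) :=
      EPT.extension M _ _ hsub (Finset.card_singleton y).le t _ le_rfl
    refine ⟨_, ⟨.single hept, fun k hk => ?_⟩, ?_, ?_⟩
    · simp only [Set.mem_union, Set.mem_singleton_iff, Set.mem_ofPred_eq, not_or, not_exists,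
        not_and] at hk
      exact extend_W_of_ne hk.1 (hk.2 y hy hyx)
    · by_cases htop : M.W (.inl (some y)) t = ⊤
      · refine Or.inr fun m hm => ?_
        rw [extend_W_source, if_pos hm, htop, Cost.oplus_top]
      · left
        dsimp only
        rw [extend_W_target, Function.update_self, Cost.ominus_self htop]
    · rintro ⟨⟨y', hy', hyx'⟩, t'⟩ hne h
      refine h.imp (fun h => ?_) fun h m hm => hept.eq_top (h m hm)
      dsimp only at h ⊢
      by_cases hyy : y' = y
      · subst hyy
        rw [extend_W_target, Function.update_of_ne (fun ht => hne (by rw [ht])), h]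
      · rw [extend_W_of_ne (by simp) (by simpa using hyy), h]

/-- The minimum cost of a hyperedge can be moved to each value of one of its variables. -/
theorem exists_reachesOn_project [∀ x, Finite (D x)] [∀ x, Nonempty (D x)]
    (N : CFN T D scope) {e : ι} {x : X} (hx : x ∈ scope e) :
    ∃ N', ReachesOn {.inr e, .inl (some x)} N N' ∧
      ∀ t, N'.W (.inl (some x)) t ≠ ⊤ →
        ∃ m, Tuple.proj (singleton_subset_fullScope hx) m = t ∧ N'.W (.inr e) m = 0 := by
  classical
  refine exists_rel_forall_of_step (τ := Tuple D (fullScope scope (.inl (some x))))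
    (ReachesOn {.inr e, .inl (some x)}) (fun N => ReachesOn.refl _ N)
    (fun _ _ _ => ReachesOn.trans) (fun t M => M.W (.inl (some x)) t ≠ ⊤ →
      ∃ m, Tuple.proj (singleton_subset_fullScope hx) m = t ∧ M.W (.inr e) m = 0) ?_ N
  intro M t
  have hsub := M.singleton_ssubset_fullScope hx
  obtain ⟨m, hm, hmin⟩ := exists_proj_eq_isMin hsub.1 t (M.W (.inr e))
  have hept : EPT M (M.project (.inr e) (.inl (some x)) hsub t (M.W (.inr e) m)) :=
    EPT.projection M _ _ hsub (Finset.card_singleton x).le t _ hmin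
  refine ⟨_, ⟨.single hept, fun k hk => ?_⟩, fun htop => ⟨m, hm, ?_⟩, fun t' ht' h htop => ?_⟩
  · simp only [Set.mem_insert_iff, Set.mem_singleton_iff, not_or] at hk
    exact project_W_of_ne hk.1 hk.2
  -- The projected minimum is finite, for otherwise the unary cost of `t` would have become `⊤`.
  · rw [project_W_source, if_pos hm, Cost.ominus_self]
    intro h
    rw [project_W_target, Function.update_self, h, Cost.oplus_top] at htop
    exact htop rfl
  · rw [project_W_target, Function.update_of_ne ht'] at htop
    obtain ⟨m', hm', h0⟩ := h htop
    refine ⟨m', hm', ?_⟩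
    rw [project_W_source, if_neg (fun h => ht' (hm'.symm.trans h)), h0]

/-- Every value of finite cost of a variable of a hyperedge gets a support of cost zero. -/
theorem exists_reachesOn_support [∀ x, Finite (D x)] [∀ x, Nonempty (D x)] (hT : 0 < T)
    (N : CFN T D scope) {e : ι} {x : X} (hx : x ∈ scope e) :
    ∃ N', ReachesOn ({.inr e} ∪ {k | ∃ y ∈ scope e, k = .inl (some y)}) N N' ∧
      ∀ t, N'.W (.inl (some x)) t ≠ ⊤ →
        ∃ m, Tuple.proj (singleton_subset_fullScope hx) m = t ∧ N'.W (.inr e) m = 0 ∧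
          ∀ (y : X) (hy : y ∈ scope e), y ≠ x →
            N'.W (.inl (some y)) (Tuple.proj (singleton_subset_fullScope hy) m) = 0 := by
  obtain ⟨N₁, h₁, hz₁⟩ := N.exists_reachesOn_extend e x
  obtain ⟨N₂, h₂, hz₂⟩ := N₁.exists_reachesOn_project hx
  refine ⟨N₂, (h₁.mono ?_).trans (h₂.mono ?_), fun t ht => ?_⟩
  · rintro k (hk | ⟨y, hy, -, rfl⟩)
    · exact Or.inl hk
    · exact Or.inr ⟨y, hy, rfl⟩
  · rintro k (rfl | rfl)
    · exact Or.inl rfl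
    · exact Or.inr ⟨x, hx, rfl⟩
  · obtain ⟨m, hm, h0⟩ := hz₂ t ht
    refine ⟨m, hm, h0, fun y hy hyx => ?_⟩
    rw [h₂.2 (.inl (some y)) (by simpa using hyx)]
    -- Cost zero after the projections excludes cost `⊤` before them, so the first alternative of
    -- the extension step applies to `m`.
    refine hz₁ m (fun h => ?_) y hy hyx
    exact Cost.zero_ne_top hT (h0.symm.trans (eq_top_of_reaches h₂.1 h))

/-- The hyperedges in `F` can be processed from the leaves to the roots, so that afterwards any
choice of unary tuples of finite cost extends to a solution. -/
theorem exists_reachesOn_forall_exists_solution [∀ x, Finite (D x)] [∀ x, Nonempty (D x)]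
    (hT : 0 < T) (hs : IsLeafEliminable scope) (F : Finset ι) (N : CFN T D scope) :
    ∃ N', ReachesOn
        ({k | ∃ i ∈ F, k = .inr i} ∪ {k | ∃ i ∈ F, ∃ y ∈ scope i, k = .inl (some y)}) N N' ∧
      ∀ Z : ∀ x, Set (Tuple D (fullScope scope (.inl (some x)))),
        (∀ x t, N'.W (.inl (some x)) t = 0 → t ∈ Z x) →
        (∀ x, ∀ t ∈ Z x, N'.W (.inl (some x)) t ≠ ⊤) → (∀ x, (Z x).Nonempty) →
        ∃ ℓ : ∀ x, D x, (∀ x, (fullScope scope (.inl (some x))).restrict ℓ ∈ Z x) ∧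
          ∀ i ∈ F, N'.W (.inr i) ((scope i).restrict ℓ) = 0 := by
  classical
  induction F using Finset.strongInduction generalizing N with
  | H F ih =>
    rcases F.eq_empty_or_nonempty with rfl | hF
    · refine ⟨N, ReachesOn.refl _ N, fun Z _ _ hZ => ?_⟩
      choose t ht using hZ
      refine ⟨fun x => t x ⟨x, Finset.mem_singleton_self x⟩, fun x => ?_, by simp⟩
      convert ht x using 1
      exact unaryTuple_ext rfl
    obtain ⟨e, he, x, hx, hleaf⟩ := hs F hF
    -- Costs are pushed out of the leaf `e` before the rest is processed, whereas the assignment is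
    -- built in the opposite order: the rest first, then `e`.
    obtain ⟨N₁, h₁, hz₁⟩ := N.exists_reachesOn_support hT hx
    obtain ⟨N₂, h₂, hz₂⟩ := ih (F.erase e) (Finset.erase_ssubset he) N₁
    refine ⟨N₂, (h₁.mono ?_).trans (h₂.mono ?_), fun Z hZ0 hZtop hZne => ?_⟩
    · rintro k (rfl | ⟨y, hy, rfl⟩)
      · exact Or.inl ⟨e, he, rfl⟩
      · exact Or.inr ⟨e, he, y, hy, rfl⟩
    · rintro k (⟨i, hi, rfl⟩ | ⟨i, hi, y, hy, rfl⟩)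
      · exact Or.inl ⟨i, Finset.mem_of_mem_erase hi, rfl⟩
      · exact Or.inr ⟨i, Finset.mem_of_mem_erase hi, y, hy, rfl⟩
    obtain ⟨ℓ, hℓZ, hℓ⟩ := hz₂ Z hZ0 hZtop hZne
    -- The value of `ℓ` at `x` has finite cost in `N₂`, hence in `N₁`, where it therefore has a
    -- support.
    obtain ⟨m, hmx, hm0, hmy⟩ := hz₁ ((fullScope scope (.inl (some x))).restrict ℓ)
      fun h => hZtop x _ (hℓZ x) (eq_top_of_reaches h₂.1 h)
    obtain ⟨ℓ', hr, hv, hi⟩ := exists_override hleaf ℓ m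
      fun _ => congrFun hmx ⟨x, Finset.mem_singleton_self x⟩
    -- Processing the rest of `F` touches neither `e` nor the unary costs of its variables other
    -- than `x`, so the zeros along `m` persist from `N₁` to `N₂`.
    have hWe : N₂.W (.inr e) = N₁.W (.inr e) := h₂.2 _ (by simp)
    have hWy : ∀ y ∈ scope e, y ≠ x →
        N₂.W (.inl (some y)) = N₁.W (.inl (some y)) := by
      intro y hy hyx
      refine h₂.2 _ ?_
      rintro (⟨i, -, hk⟩ | ⟨i, hi, z, hz, hk⟩)
      · simp at hk
      · obtain rfl : y = z := by simpa using hk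
        exact hleaf y hy hyx i (Finset.mem_of_mem_erase hi) (Finset.ne_of_mem_erase hi) hz
    refine ⟨ℓ', fun y => ?_, fun i hiF => ?_⟩
    · have hkeep : ℓ' y = ℓ y → (fullScope scope (.inl (some y))).restrict ℓ' ∈ Z y := by
        intro h
        convert hℓZ y using 1
        exact unaryTuple_ext h
      rcases hv y with ⟨hy, h⟩ | h
      · by_cases hyx : y = x
        · subst hyx
          exact hkeep (h.trans (congrFun hmx ⟨y, Finset.mem_singleton_self y⟩))
        · refine hZ0 y _ ?_
          rw [hWy y hy hyx, ← hmy y hy hyx]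
          exact congrArg _ (unaryTuple_ext h)
      · exact hkeep h
    · by_cases hie : i = e
      · subst hie
        rw [hr, hWe, hm0]
      · rw [hi i hiF hie]
        exact hℓ i (Finset.mem_erase.2 ⟨hie, hiF⟩)

/-- The minimum unary cost of each variable can be moved to the constant. -/
theorem exists_reachesOn_lowerBound [Finite X] [∀ x, Finite (D x)] [∀ x, Nonempty (D x)]
    (hT : 0 < T) (N : CFN T D scope) :
    ∃ N', (ReachesOn {k | ∃ o, k = .inl o} N N' ∧
        ∀ x t, N.W (.inl (some x)) t = 0 → N'.W (.inl (some x)) t = 0) ∧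
      ∀ x, N'.lowerBound = ⊤ ∨ ∃ t, N'.W (.inl (some x)) t = 0 := by
  classical
  refine exists_rel_forall_of_step (τ := X)
    (fun N N' : CFN T D scope => ReachesOn {k | ∃ o, k = .inl o} N N' ∧
      ∀ x t, N.W (.inl (some x)) t = 0 → N'.W (.inl (some x)) t = 0)
    (fun N => ⟨ReachesOn.refl _ N, fun _ _ h => h⟩)
    (fun _ _ _ h h' => ⟨h.1.trans h'.1, fun x t ht => h'.2 x t (h.2 x t ht)⟩)
    (fun x N' => N'.lowerBound = ⊤ ∨ ∃ t, N'.W (.inl (some x)) t = 0) ?_ N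
  intro M x
  have hsub := empty_ssubset_fullScope (scope := scope) x
  obtain ⟨m, hm, hmin⟩ := exists_proj_eq_isMin (D := D) hsub.1
    (fun z => absurd z.2 (Finset.notMem_empty z.1)) (M.W (.inl (some x)))
  have hept := EPT.projection M _ _ hsub (Finset.card_empty.trans_le zero_le_one)
    (fun z => absurd z.2 (Finset.notMem_empty z.1)) _ hmin
  have hkeep : ∀ y, y ≠ x → (M.project _ _ hsub
      (fun z => absurd z.2 (Finset.notMem_empty z.1)) (M.W (.inl (some x)) m)).W
        (.inl (some y)) = M.W (.inl (some y)) :=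
    fun y hyx => project_W_of_ne (by simpa using hyx) (by simp)
  refine ⟨_, ⟨⟨.single hept, fun k hk => ?_⟩, fun y t ht => ?_⟩, ?_, fun y hyx h => ?_⟩
  · exact project_W_of_ne (fun h => hk ⟨_, h⟩) (fun h => hk ⟨_, h⟩)
  · by_cases hyx : y = x
    · subst hyx
      rw [project_W_source, ht, Cost.zero_ominus hT, ite_self]
    · rw [hkeep y hyx, ht]
  -- If even the minimum is `⊤`, no value of `x` can become free, but the constant absorbs this `⊤`.
  · by_cases htop : M.W (.inl (some x)) m = ⊤
    · left
      rw [lowerBound, project_W_target, Function.update_self, htop, Cost.oplus_top]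
    · refine Or.inr ⟨m, ?_⟩
      rw [project_W_source, if_pos hm, Cost.ominus_self htop]
  · refine h.imp (fun h => hept.eq_top h) ?_
    rintro ⟨t, ht⟩
    exact ⟨t, by rw [hkeep y hyx, ht]⟩

theorem exists_enforcesVAC [Finite X] [Finite ι] [∀ x, Finite (D x)] [∀ x, Nonempty (D x)]
    (hT : 0 < T) (hs : IsLeafEliminable scope) (N : CFN T D scope) :
    ∃ N', N.EnforcesVAC N' := by
  have := Fintype.ofFinite ι
  obtain ⟨N₁, h₁, hz₁⟩ := exists_reachesOn_forall_exists_solution hT hs Finset.univ N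
  obtain ⟨N₂, ⟨h₂, hzero⟩, hz₂⟩ := N₁.exists_reachesOn_lowerBound hT
  refine ⟨N₂, h₁.1.trans h₂.1, ?_⟩
  by_cases hlb : N₂.lowerBound = ⊤
  · exact Or.inr hlb
  -- Moving the minima to the constant can create new unary zeros, so the zeros of `N₁` alone would
  -- not do. The zero sets of `N₂` are an admissible `Z`: they contain the zeros of `N₁` and avoid
  -- its values of cost `⊤`.
  obtain ⟨ℓ, hℓ1, hℓ2⟩ := hz₁ (fun x => {t | N₂.W (.inl (some x)) t = 0})
    hzero (fun x t ht h => Cost.zero_ne_top hT (Eq.trans (Eq.symm ht) (eq_top_of_reaches h₂.1 h)))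
    fun x => (hz₂ x).resolve_left hlb
  refine Or.inl (isVAC_of_exists ℓ ?_)
  rintro ((_ | x) | i) hj
  · exact absurd rfl hj
  · exact hℓ1 x
  · rw [h₂.2 (.inr i) (by simp)]
    exact hℓ2 i (Finset.mem_univ i)

end CFN

end Networks

/-! ### Equality of the two optima -/

section Decomposition

variable {K : Type*} [AddCommMonoid K] [LinearOrder K] [IsOrderedCancelAddMonoid K]
  [CanonicallyOrderedAdd K] [Sub K] [OrderedSub K] {T : WithTop K}

/-- By induction on the set of indices at which `f` has already been replaced by `f'`; each
replacement contributes one `v i`. -/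
theorem Cost.bigOplus_oplus_of_extra {I J : Type*} [Fintype I] [Fintype J] (f f' : J → Cost T)
    (v : I → Cost T) (φ : I → J) (hφ : Function.Injective φ)
    (h : ∀ i, f' (φ i) = (f (φ i)).oplus (v i)) (h' : ∀ j ∉ Set.range φ, f' j = f j) :
    bigOplus f' = (bigOplus f).oplus (bigOplus v) := by
  classical
  suffices key : ∀ s : Finset I, (bigOplus fun j => if j ∈ s.map ⟨φ, hφ⟩ then f' j else f j) =
      (bigOplus f).oplus ⟨min T (∑ i ∈ s, (v i).val), min_le_left _ _⟩ by
    have h1 := key Finset.univ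
    refine Eq.trans (congrArg _ (funext fun j => ?_)) h1
    split_ifs with hj
    · rfl
    · exact h' j (by simpa using hj)
  intro s
  induction s using Finset.induction_on with
  | empty =>
    refine Cost.ext ?_
    simp
  | insert i s his ih =>
    have hφi : φ i ∉ s.map ⟨φ, hφ⟩ := by simpa [hφ.eq_iff] using his
    have hstep : (bigOplus fun j => if j ∈ (insert i s).map ⟨φ, hφ⟩ then f' j else f j) =
        (bigOplus fun j => if j ∈ s.map ⟨φ, hφ⟩ then f' j else f j).oplus (v i) := by
      refine Cost.ext ?_
      rw [val_oplus, val_bigOplus, val_bigOplus, min_add_min,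
        ← Finset.add_sum_erase _ _ (Finset.mem_univ (φ i)),
        ← Finset.add_sum_erase (a := φ i) _
          (fun j => (if j ∈ s.map ⟨φ, hφ⟩ then f' j else f j).val) (Finset.mem_univ (φ i))]
      have hφi' : φ i ∈ (insert i s).map ⟨φ, hφ⟩ :=
        Finset.mem_map_of_mem ⟨φ, hφ⟩ (Finset.mem_insert_self i s)
      rw [if_pos hφi', if_neg hφi, h, val_oplus, min_add_min, add_right_comm]
      congr 3
      refine Finset.sum_congr rfl fun j hj => ?_
      have hji : j ≠ φ i := Finset.ne_of_mem_erase hj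
      have : j ∈ (insert i s).map ⟨φ, hφ⟩ ↔ j ∈ s.map ⟨φ, hφ⟩ := by
        rw [Finset.map_insert, Finset.mem_insert]
        exact or_iff_right hji
      simp only [this]
    rw [hstep, ih, oplus_assoc]
    congr 1
    refine Cost.ext ?_
    rw [val_oplus, min_add_min, Finset.sum_insert his, add_comm]

variable {S E ι : Type*} [Fintype S] [Fintype E] [Fintype ι]

theorem CFN.cost_addUnary {D : S ⊕ E → Type*} {scope : ι → Finset (S ⊕ E)} (N : CFN T D scope)
    (u : ∀ s : S, D (Sum.inl s) → Cost T) (ℓ : ∀ x, D x) :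
    (N.addUnary u).cost ℓ =
      (N.cost ℓ).oplus (Cost.bigOplus fun s => u s (ℓ (.inl s))) := by
  refine Cost.bigOplus_oplus_of_extra _ _ _ (fun s => .inl (some (.inl s)))
    (fun a b h => by simpa using h) (fun s => rfl) ?_
  rintro ((_ | (s | e)) | i) hj
  · rfl
  · exact absurd ⟨s, rfl⟩ hj
  · rfl
  · rfl

theorem CFN.cost_ofGlobal {DS : S → Type*} (hS : 2 ≤ Fintype.card S)
    (g : (∀ s, DS s) → Cost T) (u : ∀ s, DS s → Cost T) (ℓ : ∀ s, DS s) :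
    (CFN.ofGlobal hS g u).cost ℓ = (g ℓ).oplus (Cost.bigOplus fun s => u s (ℓ s)) := by
  refine Cost.ext ?_
  rw [Cost.oplus_comm, CFN.cost_def, Cost.val_bigOplus, Cost.val_oplus, Cost.val_bigOplus,
    Cost.min_add_min, Fintype.sum_sum_type, Fintype.sum_option]
  exact congrArg₂ (fun a b => min T (a + b)) (zero_add _) (Fintype.sum_unique _)

/-- The best extension of each tuple has the cost of the tuple, so the optimum is the same. -/
theorem CFN.IsOptimalCost.ofGlobal {D : S ⊕ E → Type*} {scope : ι → Finset (S ⊕ E)}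
    {g : (∀ s : S, D (Sum.inl s)) → Cost T} {N : CFN T D scope}
    (hdec : IsNetworkDecomposition g N) (hS : 2 ≤ Fintype.card S)
    {u : ∀ s : S, D (Sum.inl s) → Cost T} {w : Cost T}
    (hw : (N.addUnary u).IsOptimalCost w) : (CFN.ofGlobal hS g u).IsOptimalCost w := by
  have hle : ∀ ℓ, w ≤ (CFN.ofGlobal hS g u).cost ℓ := by
    intro ℓ
    obtain ⟨ℓ', hℓ', hg⟩ := (hdec ℓ).1
    -- The unary costs depend on the variables in `S` only, so the extension `ℓ'` that realises `g
    -- ℓ` pays the same ones as `ℓ`.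
    refine le_of_le_of_eq (hw.2 ⟨ℓ', rfl⟩) ?_
    rw [CFN.cost_addUnary, CFN.cost_ofGlobal, hg]
    rw [funext fun s => congrArg (u s) (hℓ' s)]
  refine ⟨?_, ?_⟩
  · obtain ⟨ℓ', rfl⟩ := hw.1
    refine ⟨fun s => ℓ' (.inl s), le_antisymm ?_ (hle _)⟩
    rw [CFN.cost_addUnary, CFN.cost_ofGlobal]
    exact Cost.oplus_mono ((hdec _).2 ⟨ℓ', fun _ => rfl, rfl⟩) le_rfl
  · rintro _ ⟨ℓ, rfl⟩
    exact hle ℓ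

end Decomposition

theorem mainTheorem6 {K : Type*} [AddCommMonoid K] [LinearOrder K] [IsOrderedCancelAddMonoid K]
    [CanonicallyOrderedAdd K] [Sub K] [OrderedSub K] {T : WithTop K} (hT : 0 < T)
    {S E ι : Type*} [Fintype S] [Fintype E] [Fintype ι] (hS : 2 ≤ Fintype.card S)
    {D : S ⊕ E → Type*} [∀ x, Fintype (D x)] [∀ x, Nonempty (D x)]
    {scope : ι → Finset (S ⊕ E)} (g : (∀ s : S, D (Sum.inl s)) → Cost T)
    (N : CFN T D scope) (hdec : IsNetworkDecomposition g N) (hacyc : N.IsBergeAcyclic)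
    (u : ∀ s : S, D (Sum.inl s) → Cost T) :
    (∃ N', (N.addUnary u).EnforcesVAC N') ∧
    (∃ Q', (CFN.ofGlobal hS g u).EnforcesVAC Q') ∧
    ∃ w : Cost T,
      (N.addUnary u).IsOptimalCost w ∧ (CFN.ofGlobal hS g u).IsOptimalCost w ∧
      (∀ N', (N.addUnary u).EnforcesVAC N' → N'.lowerBound = w) ∧
      (∀ Q', (CFN.ofGlobal hS g u).EnforcesVAC Q' → Q'.lowerBound = w) := by
  have hs : IsLeafEliminable scope :=
    isLeafEliminable_of_isAcyclic
      (fun i => Finset.card_pos.1 (two_pos.trans_le (N.two_le_card i))) hacyc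
  have hs' : IsLeafEliminable fun _ : Unit => (Finset.univ : Finset S) :=
    isLeafEliminable_of_subsingleton
      fun _ => Finset.card_pos.1 (two_pos.trans_le hS)
  obtain ⟨N', hN'⟩ := CFN.exists_enforcesVAC hT hs (N.addUnary u)
  have hw := hN'.isOptimalCost_lowerBound hs
  have hw' := hw.ofGlobal hdec hS
  exact ⟨⟨N', hN'⟩, CFN.exists_enforcesVAC hT hs' _, N'.lowerBound, hw, hw',
    fun N'' h => (h.isOptimalCost_lowerBound hs).unique hw,
    fun Q' h => (h.isOptimalCost_lowerBound hs').unique hw'⟩
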